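/- Let $X$ be a complex Banach space and $T$ a bounded linear operator on $X$. For a bounded operator $S$ on a normed space write $N(S)$ and $R(S)$ for its kernel and range. The ascent of $S$ is the least $n\ge 0$ with $N(S^n)=N(S^{n+1})$ and the descent of $S$ is the least $n\ge 0$ with $R(S^n)=R(S^{n+1})$ (each is $\infty$ if no such $n$ exists). The operator $S$ is - upper semi-Fredholm if $R(S)$ is closed and $\dim N(S)<\infty$; - upper semi-B-Fredholm if, for some integer $n\ge 0$, $R(S^n)$ is closed and the restriction $S_{[n]}:R(S^n)\to R(S^n)$ of $S$ is upper semi-Fredholm; - Drazin invertible if its ascent and its descent are both finite; - left Drazin invertible if its ascent $p$ is finite and $R(S^{p+1})$ is closed. Let $\sigma(T)$ be the spectrum of $T$ and let $\sigma_a(T)$ be its approximate point spectrum, i.e. the set of $\lambda\in\mathbb C$ such that $T-\lambda I$ is not bounded below. Let $\sigma_{uf}(T)$ [resp. $\sigma_{ubf}(T)$] be the set of $\lambda\in\mathbb C$ such that $T-\lambda I$ is not upper semi-Fredholm [resp. not upper semi-B-Fredholm]. Put $$p_0(T)=\{\lambda\in\sigma(T): T-\lambda I \text{ is Drazin invertible}\}\quad\text{(poles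 of } T),$$ $$p_{00}(T)=\{\lambda\in p_0(T): \dim N(T-\lambda I)<\infty\}\quad\text{(poles of } T \text{ of finite rank)},$$ $$p_0^a(T)=\{\lambda\in\sigma_a(T): T-\lambda I \text{ is left Drazin invertible}\}\quad\text{(left poles of } T).$$ The operator $T$ satisfies property $(bz_1)$ if $\sigma_a(T)\setminus\sigma_{uf}(T)=p_{00}(T)$, and property $(gbz_1)$ if $\sigma_a(T)\setminus\sigma_{ubf}(T)=p_0(T)$. Then $T$ satisfies property $(gbz_1)$ if and only if $T$ satisfies property $(bz_1)$ and $p_0(T)=p_0^a(T)$. In particular, property $(gbz_1)$ implies property $(bz_1)$. -/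

import Mathlib

noncomputable section

namespace BFredholm

variable {E : Type*} [NormedAddCommGroup E] [NormedSpace ℂ E]

/-- `S` is upper semi-Fredholm: closed range and finite-dimensional kernel. The space `E` need not
be complete here, since this is also applied to the restrictions `restrictPow S n`. -/
def IsUpperSemiFredholm (S : E →L[ℂ] E) : Prop :=
  IsClosed (Set.range S) ∧ FiniteDimensional ℂ S.ker

/-- The range `R(S ^ n)`. -/
def rangePow (S : E →L[ℂ] E) (n : ℕ) : Submodule ℂ E := (S ^ n).range

theorem mapsTo_rangePow (S : E →L[ℂ] E) (n : ℕ) :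
    Set.MapsTo S (rangePow S n) (rangePow S n) := by
  rintro _ ⟨x, rfl⟩
  refine ⟨S x, ?_⟩
  have h : S ^ n * S = S * S ^ n := (Commute.pow_self S n).eq
  exact congrArg (fun A : E →L[ℂ] E => A x) h

/-- The operator `S_[n] : R(S ^ n) → R(S ^ n)` induced by `S`. -/
def restrictPow (S : E →L[ℂ] E) (n : ℕ) : rangePow S n →L[ℂ] rangePow S n :=
  S.restrict (mapsTo_rangePow S n)

/-- `S` is upper semi-B-Fredholm: for some `n`, the range `R(S ^ n)` is closed and `S_[n]` is upper
semi-Fredholm. -/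
def IsUpperSemiBFredholm (S : E →L[ℂ] E) : Prop :=
  ∃ n : ℕ, IsClosed (rangePow S n : Set E) ∧ IsUpperSemiFredholm (restrictPow S n)

/-- `S` has finite ascent, equal to `p`. -/
def HasAscent (S : E →L[ℂ] E) (p : ℕ) : Prop :=
  IsLeast {n : ℕ | (S ^ n).ker = (S ^ (n + 1)).ker} p

/-- `S` has finite descent, equal to `q`. -/
def HasDescent (S : E →L[ℂ] E) (q : ℕ) : Prop :=
  IsLeast {n : ℕ | rangePow S n = rangePow S (n + 1)} q

/-- `S` is Drazin invertible: its ascent and its descent are finite. -/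
def IsDrazinInvertible (S : E →L[ℂ] E) : Prop :=
  (∃ p, HasAscent S p) ∧ ∃ q, HasDescent S q

/-- `S` is left Drazin invertible: its ascent `p` is finite and `R(S ^ (p + 1))` is closed. -/
def IsLeftDrazinInvertible (S : E →L[ℂ] E) : Prop :=
  ∃ p, HasAscent S p ∧ IsClosed (rangePow S (p + 1) : Set E)

/-- The operator `T - z I`. -/
def shift (T : E →L[ℂ] E) (z : ℂ) : E →L[ℂ] E := T - z • ContinuousLinearMap.id ℂ E

/-- The approximate point spectrum: the `z` such that `T - z I` is not bounded below. -/
def approxPointSpectrum (T : E →L[ℂ] E) : Set ℂ :=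
  {z | ¬ ∃ c : ℝ, 0 < c ∧ ∀ x : E, c * ‖x‖ ≤ ‖shift T z x‖}

/-- The upper semi-Fredholm spectrum. -/
def usfSpectrum (T : E →L[ℂ] E) : Set ℂ := {z | ¬ IsUpperSemiFredholm (shift T z)}

/-- The upper semi-B-Fredholm spectrum. -/
def usbfSpectrum (T : E →L[ℂ] E) : Set ℂ := {z | ¬ IsUpperSemiBFredholm (shift T z)}

/-- The Drazin spectrum. -/
def drazinSpectrum (T : E →L[ℂ] E) : Set ℂ := {z | ¬ IsDrazinInvertible (shift T z)}

/-- The left Drazin spectrum. -/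
def leftDrazinSpectrum (T : E →L[ℂ] E) : Set ℂ := {z | ¬ IsLeftDrazinInvertible (shift T z)}

/-- The set `p₀(T)` of poles of `T`. -/
def poles (T : E →L[ℂ] E) : Set ℂ := spectrum ℂ T \ drazinSpectrum T

/-- The set `p₀₀(T)` of poles of `T` of finite rank: the eigenspace is finite-dimensional. -/
def finiteRankPoles (T : E →L[ℂ] E) : Set ℂ :=
  {z ∈ poles T | FiniteDimensional ℂ (shift T z).ker}

/-- The set `p₀ᵃ(T)` of left poles of `T`. -/
def leftPoles (T : E →L[ℂ] E) : Set ℂ := approxPointSpectrum T \ leftDrazinSpectrum T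

/-- Property `(bz₁)`. -/
def PropertyBz1 (T : E →L[ℂ] E) : Prop :=
  approxPointSpectrum T \ usfSpectrum T = finiteRankPoles T

/-- Property `(gbz₁)`. -/
def PropertyGbz1 (T : E →L[ℂ] E) : Prop :=
  approxPointSpectrum T \ usbfSpectrum T = poles T

end BFredholm

end

/-! Left Drazin invertible operators are upper semi-B-Fredholm, so left poles always lie in `σ_a \
σ_ubf`; the question is when equality holds. For `S` upper semi-B-Fredholm, the ranges `R(S ^ m)`
are eventually closed and the finite-dimensional spaces `N(S) ∩ R(S ^ m)` eventually constant. If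
the constant value is zero, `S` is left Drazin invertible. If not, `S` is surjective with nonzero
finite-dimensional kernel on the closed space `⋂ R(S ^ m)`, and a Neumann series makes every small
scalar an eigenvalue (`isLeftDrazinInvertible_or`).

Under `(bz₁)` the second case cannot occur for `S = T - a`: small nonzero shifts of `S` are upper
semi-Fredholm, so nearby points `a + r` would be poles, whereas eigenvalues do not accumulate at a
pole. The other implications rest on Neubauer's lemma, which makes Drazin invertible operators left
Drazin invertible and, when the kernel is finite-dimensional, upper semi-Fredholm. -/

namespace BFredholm

/-! ### Closed ranges and finite-dimensional kernels -/

section Banach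

variable {Y Z : Type*} [NormedAddCommGroup Y] [NormedSpace ℂ Y] [CompleteSpace Y]
  [NormedAddCommGroup Z] [NormedSpace ℂ Z]

/-- Neubauer's lemma: an operator range whose direct sum with a closed subspace is closed is itself
closed. -/
theorem isClosed_range_of_isClosed_range_sup [CompleteSpace Z] (B : Y →L[ℂ] Z) (G : Submodule ℂ Z)
    (hG : IsClosed (G : Set Z)) (hd : Disjoint B.range G)
    (hs : IsClosed ((B.range ⊔ G : Submodule ℂ Z) : Set Z)) :
    IsClosed (B.range : Set Z) := by
  have : CompleteSpace G := hG.completeSpace_coe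
  let K : Submodule ℂ Z := B.range ⊔ G
  have : CompleteSpace K := hs.completeSpace_coe
  have hmem : ∀ p : Y × G, B.coprod G.subtypeL p ∈ K := fun p =>
    Submodule.add_mem_sup ⟨p.1, rfl⟩ p.2.2
  -- A surjection of Banach spaces is a quotient map, so closedness of `R(B)` in `K` can be tested
  -- on its preimage `Y × {0}`.
  let Φ : Y × G →L[ℂ] K := (B.coprod G.subtypeL).codRestrict K hmem
  have hΦ : Function.Surjective Φ := by
    rintro ⟨z, hz⟩
    obtain ⟨_, ⟨y, rfl⟩, g, hg, rfl⟩ := Submodule.mem_sup.1 hz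
    exact ⟨(y, ⟨g, hg⟩), rfl⟩
  have hpre : Φ ⁻¹' (Subtype.val ⁻¹' (B.range : Set Z)) = Prod.snd ⁻¹' {(0 : G)} := by
    ext ⟨y, g⟩
    have hval : ((Φ (y, g) : K) : Z) = B y + g := rfl
    simp only [Set.mem_preimage, hval, Set.mem_singleton_iff, SetLike.mem_coe]
    constructor
    · intro h
      have hg : (g : Z) ∈ B.range := by
        have := B.range.sub_mem h (⟨y, rfl⟩ : B y ∈ B.range)
        simpa using this
      exact Subtype.ext (Submodule.disjoint_def.1 hd _ hg g.2)
    · rintro rfl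
      simp
  have hcl : IsClosed (Subtype.val ⁻¹' (B.range : Set Z) : Set K) := by
    rw [← (Φ.isQuotientMap hΦ).isClosed_preimage, hpre]
    exact isClosed_singleton.preimage continuous_snd
  have := hs.isClosedEmbedding_subtypeVal.isClosedMap _ hcl
  have hi : Subtype.val '' (Subtype.val ⁻¹' (B.range : Set Z) : Set K) = B.range := by
    refine (Subtype.image_preimage_coe _ _).trans (Set.inter_eq_right.2 ?_)
    exact SetLike.coe_subset_coe.2 (le_sup_left : B.range ≤ K)
  exact (congrArg IsClosed hi).mp this

/-- An operator range is closed as soon as its sum with a finite-dimensional subspace is closed. -/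
theorem isClosed_range_of_isClosed_range_sup_finiteDimensional [CompleteSpace Z] (B : Y →L[ℂ] Z)
    (F : Submodule ℂ Z) [FiniteDimensional ℂ F]
    (hs : IsClosed ((B.range ⊔ F : Submodule ℂ Z) : Set Z)) :
    IsClosed (B.range : Set Z) := by
  obtain ⟨G, hGle, hG⟩ : ∃ G ≤ F, Disjoint B.range G ∧ B.range ⊔ G = B.range ⊔ F := by
    -- `G'` is a complement in all of `Z`; the modular law makes `G' ⊓ F` a complement of `R(B) ⊓ F`
    -- inside `F`.
    obtain ⟨G', hG'⟩ := (B.range ⊓ F).exists_isCompl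
    refine ⟨G' ⊓ F, inf_le_right, ?_, ?_⟩
    · rw [disjoint_iff, ← inf_assoc, inf_right_comm, hG'.inf_eq_bot]
    · have hF : F = (B.range ⊓ F) ⊔ (G' ⊓ F) := by
        rw [← sup_inf_assoc_of_le G' (inf_le_right : B.range ⊓ F ≤ F), hG'.sup_eq_top, top_inf_eq]
      conv_rhs => rw [hF, ← sup_assoc, sup_inf_self]
  have : FiniteDimensional ℂ G := Submodule.finiteDimensional_of_le hGle
  exact isClosed_range_of_isClosed_range_sup B G G.closed_of_finiteDimensional hG.1
    (by rw [hG.2]; exact hs)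

/-- An operator that is bounded below on a closed subspace maps it onto a closed subspace. -/
theorem isClosed_map_of_bound (A : Y →L[ℂ] Z) (W : Submodule ℂ Y)
    (hW : IsClosed (W : Set Y)) {c : ℝ} (hc : 0 < c) (h : ∀ x ∈ W, c * ‖x‖ ≤ ‖A x‖) :
    IsClosed (A '' (W : Set Y)) := by
  have : CompleteSpace W := hW.completeSpace_coe
  have hanti : AntilipschitzWith (Real.toNNReal c⁻¹) (A.comp W.subtypeL) := by
    refine ContinuousLinearMap.antilipschitz_of_bound _ fun x => ?_
    rw [Real.coe_toNNReal _ (inv_nonneg.2 hc.le), inv_mul_eq_div, le_div_iff₀' hc]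
    exact h x x.2
  have := hanti.isClosed_range (A.comp W.subtypeL).uniformContinuous
  have he : Set.range (A.comp W.subtypeL) = A '' (W : Set Y) := by
    ext z
    simp
  rwa [he] at this

/-- On a closed complement of the kernel `A` is injective with the same closed range, so the open
mapping theorem bounds it below. -/
theorem exists_isCompl_ker_bound [CompleteSpace Z] (A : Y →L[ℂ] Z)
    (hA : IsClosed (A.range : Set Z)) [FiniteDimensional ℂ A.ker] :
    ∃ W : Submodule ℂ Y, IsClosed (W : Set Y) ∧ IsCompl A.ker W ∧
      ∃ c : ℝ, 0 < c ∧ ∀ x ∈ W, c * ‖x‖ ≤ ‖A x‖ := by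
  obtain ⟨W, hW, hc⟩ :=
    (Submodule.ClosedComplemented.of_finiteDimensional A.ker).exists_isClosed_isCompl
  have : CompleteSpace W := hW.completeSpace_coe
  refine ⟨W, hW, hc, ?_⟩
  have hinj : Function.Injective (A.comp W.subtypeL) := by
    rw [injective_iff_map_eq_zero]
    intro x hx
    exact Subtype.ext (Submodule.disjoint_def.1 hc.disjoint _ hx x.2)
  have hr : Set.range (A.comp W.subtypeL) = A.range := by
    apply Set.Subset.antisymm
    · rintro _ ⟨x, rfl⟩
      exact ⟨x, rfl⟩
    · rintro _ ⟨x, rfl⟩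
      obtain ⟨k, hk, w, hw, rfl⟩ :=
        Submodule.mem_sup.1 (hc.sup_eq_top ▸ Submodule.mem_top : x ∈ A.ker ⊔ W)
      refine ⟨⟨w, hw⟩, ?_⟩
      have : A k = 0 := hk
      simp [this]
  obtain ⟨K, hK⟩ := (A.comp W.subtypeL).antilipschitz_of_injective_of_isClosed_range hinj
    (by rw [hr]; exact hA)
  refine ⟨((K : ℝ) + 1)⁻¹, by positivity, fun x hx => ?_⟩
  have h1 : ‖x‖ ≤ K * ‖A x‖ := by
    simpa using hK.le_mul_dist (⟨x, hx⟩ : W) 0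
  rw [inv_mul_le_iff₀ (by positivity)]
  nlinarith [norm_nonneg (A x)]

/-- An operator with closed range and finite-dimensional kernel maps closed subspaces to closed
subspaces. -/
theorem isClosed_image_of_finiteDimensional_ker [CompleteSpace Z] (A : Y →L[ℂ] Z)
    (hA : IsClosed (A.range : Set Z)) [FiniteDimensional ℂ A.ker] (C : Submodule ℂ Y)
    (hC : IsClosed (C : Set Y)) : IsClosed (A '' (C : Set Y)) := by
  obtain ⟨W, hW, hc, c, hc0, hb⟩ := exists_isCompl_ker_bound A hA
  have h := isClosed_map_of_bound A ((C ⊔ A.ker) ⊓ W)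
    ((Submodule.isClosed_sup_finiteDimensional C A.ker hC).inter hW) hc0 fun x hx => hb x hx.2
  convert h using 1
  apply Set.Subset.antisymm
  · rintro _ ⟨x, hx, rfl⟩
    obtain ⟨k, hk, w, hw, rfl⟩ :=
      Submodule.mem_sup.1 (hc.sup_eq_top ▸ Submodule.mem_top : x ∈ A.ker ⊔ W)
    have hk0 : A k = 0 := hk
    refine ⟨w, ⟨?_, hw⟩, by simp [hk0]⟩
    have : w = (k + w) + (-k) := by abel
    rw [this]
    exact Submodule.add_mem_sup hx (neg_mem hk)
  · rintro _ ⟨x, ⟨hx, -⟩, rfl⟩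
    obtain ⟨y, hy, k, hk, rfl⟩ := Submodule.mem_sup.1 hx
    have hk0 : A k = 0 := hk
    exact ⟨y, hy, by simp [hk0]⟩

/-- Having closed range and finite-dimensional kernel is an open condition. -/
theorem exists_pos_forall_isClosed_range_sub [CompleteSpace Z] (A J : Y →L[ℂ] Z)
    (hA : IsClosed (A.range : Set Z)) [FiniteDimensional ℂ A.ker] :
    ∃ ε : ℝ, 0 < ε ∧ ∀ z : ℂ, ‖z‖ < ε →
      IsClosed ((A - z • J).range : Set Z) ∧ FiniteDimensional ℂ (A - z • J).ker := by
  obtain ⟨W, hW, hc, c, hc0, hb⟩ := exists_isCompl_ker_bound A hA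
  -- With this radius the perturbation costs at most half of the lower bound `c` on `W`.
  refine ⟨c / 2 / (‖J‖ + 1), by positivity, fun z hz => ?_⟩
  have hz' : ‖z‖ * ‖J‖ ≤ c / 2 := by
    rw [lt_div_iff₀ (by positivity)] at hz
    nlinarith [norm_nonneg z]
  have hb' : ∀ x ∈ W, c / 2 * ‖x‖ ≤ ‖(A - z • J) x‖ := by
    intro x hx
    have h1 := hb x hx
    have h2 : ‖A x‖ - ‖z • J x‖ ≤ ‖A x - z • J x‖ := norm_sub_norm_le _ _
    have h3 : ‖z • J x‖ ≤ ‖z‖ * ‖J‖ * ‖x‖ := by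
      rw [norm_smul, mul_assoc]
      exact mul_le_mul_of_nonneg_left (J.le_opNorm x) (norm_nonneg z)
    have h4 := mul_le_mul_of_nonneg_right hz' (norm_nonneg x)
    change _ ≤ ‖A x - z • J x‖
    linarith
  set B := A - z • J
  constructor
  · have h1 : IsClosed ((W.map (B : Y →ₗ[ℂ] Z) : Submodule ℂ Z) : Set Z) :=
      isClosed_map_of_bound B W hW (half_pos hc0) hb'
    have h2 := Submodule.isClosed_sup_finiteDimensional _ (A.ker.map (B : Y →ₗ[ℂ] Z)) h1
    rw [← Submodule.map_sup, sup_comm, hc.sup_eq_top] at h2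
    rwa [Submodule.map_top] at h2
  · have hdis : Disjoint W B.ker := by
      rw [Submodule.disjoint_def]
      intro x hx hx'
      have h0 : B x = 0 := hx'
      have h1 := hb' x hx
      rw [h0, norm_zero] at h1
      have : ‖x‖ ≤ 0 := by nlinarith
      simpa using this
    let e := W.quotientEquivOfIsCompl A.ker hc.symm
    have : FiniteDimensional ℂ (Y ⧸ W) := e.symm.finiteDimensional
    -- The perturbed kernel meets `W` trivially, so it embeds in `Y ⧸ W`, which is isomorphic to
    -- `N(A)`.
    refine FiniteDimensional.of_injective (W.mkQ.comp B.ker.subtype) ?_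
    rw [← LinearMap.ker_eq_bot, LinearMap.ker_eq_bot']
    intro x hx
    have hxW : (x : Y) ∈ W := by simpa using hx
    exact Subtype.ext (Submodule.disjoint_def.1 hdis _ hxW x.2)

/-- A surjective operator with nonzero finite-dimensional kernel stays noninjective under small
perturbations. -/
theorem exists_pos_forall_exists_ne_zero (f : Y →L[ℂ] Y) (hf : Function.Surjective f)
    [FiniteDimensional ℂ f.ker] {x₀ : Y} (hx₀ : f x₀ = 0) (hne : x₀ ≠ 0) :
    ∃ ε : ℝ, 0 < ε ∧ ∀ z : ℂ, ‖z‖ < ε → ∃ y : Y, y ≠ 0 ∧ f y = z • y := by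
  obtain ⟨g, hg⟩ : ∃ g : Y →L[ℂ] Y, ∀ y, f (g y) = y := by
    obtain ⟨W, hW, hc⟩ :=
      (Submodule.ClosedComplemented.of_finiteDimensional f.ker).exists_isClosed_isCompl
    have : CompleteSpace W := hW.completeSpace_coe
    have hker : (f.comp W.subtypeL).ker = ⊥ := by
      rw [LinearMap.ker_eq_bot']
      intro x hx
      exact Subtype.ext (Submodule.disjoint_def.1 hc.disjoint _ hx x.2)
    have hrange : (f.comp W.subtypeL).range = ⊤ := by
      rw [LinearMap.range_eq_top]
      intro y
      obtain ⟨x, rfl⟩ := hf y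
      obtain ⟨k, hk, w, hw, rfl⟩ :=
        Submodule.mem_sup.1 (hc.sup_eq_top ▸ Submodule.mem_top : x ∈ f.ker ⊔ W)
      have hk0 : f k = 0 := hk
      exact ⟨⟨w, hw⟩, by simp [hk0]⟩
    let e := ContinuousLinearEquiv.ofBijective (f.comp W.subtypeL) hker hrange
    exact ⟨W.subtypeL.comp (e.symm : Y →L[ℂ] W), fun y => e.apply_symm_apply y⟩
  refine ⟨(‖g‖ + 1)⁻¹, by positivity, fun z hz => ?_⟩
  have hlt : ‖z • g‖ < 1 := by
    rw [norm_smul]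
    have h1 := mul_lt_mul_of_pos_right hz (show 0 < ‖g‖ + 1 by positivity)
    rw [inv_mul_cancel₀ (by positivity)] at h1
    nlinarith [norm_nonneg z]
  -- With `g` a right inverse of `f`, the vector `y = (1 - z g)⁻¹ x₀` satisfies `y - z g y = x₀`;
  -- applying `f` gives `f y = z y`.
  let u := Units.oneSub (z • g) hlt
  have h1 : (1 - z • g) ((↑u⁻¹ : Y →L[ℂ] Y) x₀) = x₀ :=
    congrArg (fun A : Y →L[ℂ] Y => A x₀) u.mul_inv
  set y := (↑u⁻¹ : Y →L[ℂ] Y) x₀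
  have h2 : y - z • g y = x₀ := h1
  refine ⟨y, ?_, ?_⟩
  · intro hy
    apply hne
    rw [← h2, hy]
    simp
  · have h3 := congrArg f h2
    rw [map_sub, map_smul, hg, hx₀] at h3
    exact sub_eq_zero.1 h3

end Banach

/-! ### Ranges and kernels of powers, ascent and descent -/

section Powers

variable {X : Type*} [NormedAddCommGroup X] [NormedSpace ℂ X]

theorem pow_succ_apply_left (S : X →L[ℂ] X) (n : ℕ) (x : X) : (S ^ (n + 1)) x = S ((S ^ n) x) := by
  rw [pow_succ']
  rfl

theorem pow_succ_apply_right (S : X →L[ℂ] X) (n : ℕ) (x : X) :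
    (S ^ (n + 1)) x = (S ^ n) (S x) := by
  rw [pow_succ]
  rfl

theorem pow_add_apply (S : X →L[ℂ] X) (m n : ℕ) (x : X) :
    (S ^ (m + n)) x = (S ^ m) ((S ^ n) x) := by
  rw [pow_add]
  rfl

theorem antitone_rangePow (S : X →L[ℂ] X) : Antitone (rangePow S) := by
  refine antitone_nat_of_succ_le fun n => ?_
  rintro _ ⟨x, rfl⟩
  exact ⟨S x, (pow_succ_apply_right S n x).symm⟩

theorem image_rangePow (S : X →L[ℂ] X) (n : ℕ) :
    S '' (rangePow S n : Set X) = rangePow S (n + 1) := by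
  apply Set.Subset.antisymm
  · rintro _ ⟨_, ⟨x, rfl⟩, rfl⟩
    exact ⟨x, pow_succ_apply_left S n x⟩
  · rintro _ ⟨x, rfl⟩
    exact ⟨(S ^ n) x, ⟨x, rfl⟩, (pow_succ_apply_left S n x).symm⟩

theorem range_comp_subtypeL_rangePow (S : X →L[ℂ] X) (n : ℕ) :
    (S.comp (rangePow S n).subtypeL).range = rangePow S (n + 1) := by
  apply SetLike.coe_injective
  rw [← image_rangePow]
  ext z
  simp

theorem finiteDimensional_ker_comp_subtypeL {S : X →L[ℂ] X} {M : Submodule ℂ X} :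
    FiniteDimensional ℂ (S.comp M.subtypeL).ker ↔
      FiniteDimensional ℂ (S.ker ⊓ M : Submodule ℂ X) := by
  have h : (S.comp M.subtypeL).ker.map M.subtype = S.ker ⊓ M := by
    ext x
    constructor
    · rintro ⟨y, hy, rfl⟩
      exact ⟨hy, y.2⟩
    · rintro ⟨hx, hxM⟩
      exact ⟨⟨x, hxM⟩, hx, rfl⟩
  rw [← h]
  let e := Submodule.equivMapOfInjective M.subtype M.injective_subtype (S.comp M.subtypeL).ker
  exact ⟨fun _ => e.finiteDimensional, fun _ => e.symm.finiteDimensional⟩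

theorem isUpperSemiFredholm_restrictPow_iff {S : X →L[ℂ] X} {n : ℕ}
    (hn : IsClosed (rangePow S n : Set X)) :
    IsUpperSemiFredholm (restrictPow S n) ↔ IsClosed (rangePow S (n + 1) : Set X) ∧
      FiniteDimensional ℂ (S.ker ⊓ rangePow S n : Submodule ℂ X) := by
  have hi : Subtype.val '' Set.range (restrictPow S n) = (rangePow S (n + 1) : Set X) := by
    rw [← image_rangePow]
    ext z
    constructor
    · rintro ⟨_, ⟨x, rfl⟩, rfl⟩
      exact ⟨x, x.2, rfl⟩
    · rintro ⟨x, hx, rfl⟩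
      exact ⟨_, ⟨⟨x, hx⟩, rfl⟩, rfl⟩
  have hk : (restrictPow S n).ker = (S.comp (rangePow S n).subtypeL).ker := by
    ext x
    exact Subtype.ext_iff
  have hc : IsClosed (Set.range (restrictPow S n)) ↔ IsClosed (rangePow S (n + 1) : Set X) :=
    hn.isClosedEmbedding_subtypeVal.isClosed_iff_image_isClosed.trans
      (iff_of_eq (congrArg IsClosed hi))
  rw [IsUpperSemiFredholm, hc, hk, finiteDimensional_ker_comp_subtypeL]

theorem isUpperSemiBFredholm_iff {S : X →L[ℂ] X} :
    IsUpperSemiBFredholm S ↔ ∃ n, IsClosed (rangePow S n : Set X) ∧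
      IsClosed (rangePow S (n + 1) : Set X) ∧
      FiniteDimensional ℂ (S.ker ⊓ rangePow S n : Submodule ℂ X) :=
  exists_congr fun _ => and_congr_right fun h => isUpperSemiFredholm_restrictPow_iff h

theorem rangePow_zero (S : X →L[ℂ] X) : rangePow S 0 = ⊤ :=
  Submodule.eq_top_iff'.2 fun x => ⟨x, rfl⟩

theorem coe_rangePow_one (S : X →L[ℂ] X) : (rangePow S 1 : Set X) = Set.range S := by
  rw [← zero_add 1, ← image_rangePow, rangePow_zero, Submodule.top_coe, Set.image_univ]

theorem IsUpperSemiFredholm.isUpperSemiBFredholm {S : X →L[ℂ] X} (h : IsUpperSemiFredholm S) :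
    IsUpperSemiBFredholm S := by
  rw [isUpperSemiBFredholm_iff]
  have := h.2
  refine ⟨0, ?_, ?_, Submodule.finiteDimensional_of_le (inf_le_left : S.ker ⊓ _ ≤ S.ker)⟩
  · rw [rangePow_zero]
    exact isClosed_univ
  · rw [zero_add, coe_rangePow_one]
    exact h.1

/-- Since `S ^ n` maps `N(S ^ (n + 1))` onto `N(S) ∩ R(S ^ n)`, finite ascent becomes a condition on
this decreasing family. -/
theorem ker_pow_eq_succ_iff {S : X →L[ℂ] X} {n : ℕ} :
    (S ^ n).ker = (S ^ (n + 1)).ker ↔ S.ker ⊓ rangePow S n = ⊥ := by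
  constructor
  · intro h
    rw [eq_bot_iff]
    rintro _ ⟨hx, ⟨y, rfl⟩⟩
    have hy : y ∈ (S ^ (n + 1)).ker := (pow_succ_apply_left S n y).trans hx
    rw [← h] at hy
    exact hy
  · intro h
    apply le_antisymm
    · intro x hx
      have hx0 : (S ^ n) x = 0 := hx
      exact (pow_succ_apply_left S n x).trans (by rw [hx0, map_zero])
    · intro x hx
      have : (S ^ n) x ∈ S.ker ⊓ rangePow S n :=
        ⟨(pow_succ_apply_left S n x).symm.trans hx, ⟨x, rfl⟩⟩
      rw [h] at this
      exact this

theorem HasAscent.ker_inf_rangePow {S : X →L[ℂ] X} {p m : ℕ} (h : HasAscent S p) (hm : p ≤ m) :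
    S.ker ⊓ rangePow S m = ⊥ := by
  have h1 := ker_pow_eq_succ_iff.1 h.1
  rw [eq_bot_iff, ← h1]
  exact inf_le_inf_left _ (antitone_rangePow S hm)

theorem exists_hasAscent {S : X →L[ℂ] X} {n : ℕ} (h : S.ker ⊓ rangePow S n = ⊥) :
    ∃ p ≤ n, HasAscent S p := by
  classical
  have hex : ∃ n, (S ^ n).ker = (S ^ (n + 1)).ker := ⟨n, ker_pow_eq_succ_iff.2 h⟩
  exact ⟨Nat.find hex, Nat.find_min' hex (ker_pow_eq_succ_iff.2 h), Nat.find_spec hex,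
    fun m hm => Nat.find_min' hex hm⟩

/-- Lets closedness descend from `R(S ^ (m + 1))` to `R(S ^ m)`: the sum is closed as a preimage,
and Neubauer's lemma removes the kernel. -/
theorem preimage_rangePow_succ (S : X →L[ℂ] X) (m : ℕ) :
    ((rangePow S m ⊔ S.ker : Submodule ℂ X) : Set X) = S ⁻¹' (rangePow S (m + 1) : Set X) := by
  ext x
  constructor
  · intro hx
    obtain ⟨_, ⟨y, rfl⟩, k, hk, rfl⟩ := Submodule.mem_sup.1 hx
    have hk0 : S k = 0 := hk
    refine ⟨y, ?_⟩
    rw [map_add, hk0, add_zero]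
    exact pow_succ_apply_left S m y
  · rintro ⟨y, hy⟩
    refine Submodule.mem_sup.2 ⟨(S ^ m) y, ⟨y, rfl⟩, x - (S ^ m) y, ?_, by abel⟩
    change S (x - (S ^ m) y) = 0
    rw [map_sub, ← pow_succ_apply_left, sub_eq_zero]
    exact hy.symm

theorem rangePow_eq_of_hasDescent {S : X →L[ℂ] X} {q m : ℕ} (h : HasDescent S q) (hm : q ≤ m) :
    rangePow S m = rangePow S q := by
  induction m, hm using Nat.le_induction with
  | base => rfl
  | succ m hm ih =>
    have h1 : rangePow S q = rangePow S (q + 1) := h.1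
    apply SetLike.coe_injective
    rw [← image_rangePow, ih, image_rangePow, ← h1]

theorem ker_pow_eq_of_hasAscent {S : X →L[ℂ] X} {p m : ℕ} (h : HasAscent S p) (hm : p ≤ m) :
    (S ^ m).ker = (S ^ p).ker := by
  induction m, hm using Nat.le_induction with
  | base => rfl
  | succ m hm ih => rw [← ih, ← ker_pow_eq_succ_iff.2 (h.ker_inf_rangePow hm)]

theorem pow_apply_of_eq_smul {S : X →L[ℂ] X} {z : ℂ} {x : X} (h : S x = z • x) (n : ℕ) :
    (S ^ n) x = z ^ n • x := by
  induction n with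
  | zero => simp
  | succ n ih => rw [pow_succ_apply_right, h, map_smul, ih, smul_smul, pow_succ']

theorem mem_rangePow_of_eq_smul {S : X →L[ℂ] X} {z : ℂ} (hz : z ≠ 0) {x : X} (h : S x = z • x)
    (n : ℕ) : x ∈ rangePow S n := by
  refine ⟨(z ^ n)⁻¹ • x, ?_⟩
  change (S ^ n) ((z ^ n)⁻¹ • x) = x
  rw [map_smul, pow_apply_of_eq_smul h, inv_smul_smul₀ (pow_ne_zero n hz)]

variable [CompleteSpace X]

theorem isClosed_rangePow_of_succ {S : X →L[ℂ] X} {m : ℕ} (hd : S.ker ⊓ rangePow S m = ⊥)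
    (h : IsClosed (rangePow S (m + 1) : Set X)) : IsClosed (rangePow S m : Set X) := by
  refine isClosed_range_of_isClosed_range_sup (S ^ m) S.ker S.isClosed_ker ?_ ?_
  · rw [disjoint_comm, disjoint_iff]
    exact hd
  · exact (preimage_rangePow_succ S m).symm ▸ h.preimage S.continuous

theorem isClosed_rangePow_of_succ_of_finiteDimensional {S : X →L[ℂ] X} {m : ℕ}
    [FiniteDimensional ℂ S.ker]
    (h : IsClosed (rangePow S (m + 1) : Set X)) : IsClosed (rangePow S m : Set X) :=
  isClosed_range_of_isClosed_range_sup_finiteDimensional (S ^ m) S.ker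
    ((preimage_rangePow_succ S m).symm ▸ h.preimage S.continuous)

theorem HasAscent.isClosed_rangePow {S : X →L[ℂ] X} {p k m : ℕ} (hp : HasAscent S p) (hk : p ≤ k)
    (hkm : k ≤ m) (h : IsClosed (rangePow S m : Set X)) : IsClosed (rangePow S k : Set X) := by
  induction m, hkm using Nat.le_induction with
  | base => exact h
  | succ m hm ih => exact ih (isClosed_rangePow_of_succ (hp.ker_inf_rangePow (hk.trans hm)) h)

theorem isLeftDrazinInvertible_of_isClosed {S : X →L[ℂ] X} {n : ℕ}
    (hd : S.ker ⊓ rangePow S n = ⊥) (h : IsClosed (rangePow S (n + 1) : Set X)) :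
    IsLeftDrazinInvertible S := by
  obtain ⟨p, hpn, hp⟩ := exists_hasAscent hd
  exact ⟨p, hp, hp.isClosed_rangePow (Nat.le_succ p) (Nat.succ_le_succ hpn) h⟩

theorem IsLeftDrazinInvertible.isUpperSemiBFredholm {S : X →L[ℂ] X}
    (h : IsLeftDrazinInvertible S) : IsUpperSemiBFredholm S := by
  obtain ⟨p, hp, hc⟩ := h
  rw [isUpperSemiBFredholm_iff]
  have hb := hp.ker_inf_rangePow le_rfl
  refine ⟨p, isClosed_rangePow_of_succ hb hc, hc, ?_⟩
  rw [hb]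
  infer_instance

/-- For `m` beyond both ascent and descent, `X = R(S ^ m) ⊕ N(S ^ m)`, so Neubauer's lemma closes
the range. -/
theorem IsDrazinInvertible.exists_isClosed_rangePow {S : X →L[ℂ] X} (h : IsDrazinInvertible S) :
    ∃ p q, HasAscent S p ∧ IsClosed (rangePow S (p + q + 1) : Set X) := by
  obtain ⟨⟨p, hp⟩, q, hq⟩ := h
  refine ⟨p, q, hp, ?_⟩
  set m := p + q + 1 with hm
  refine isClosed_range_of_isClosed_range_sup (S ^ m) (S ^ m).ker (S ^ m).isClosed_ker ?_ ?_
  · rw [Submodule.disjoint_def]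
    rintro _ ⟨y, rfl⟩ hy
    have hy' : y ∈ (S ^ (m + m)).ker := (pow_add_apply S m m y).trans hy
    rw [ker_pow_eq_of_hasAscent hp (by omega), ← ker_pow_eq_of_hasAscent hp (by omega : p ≤ m)]
      at hy'
    exact hy'
  · have : (S ^ m).range ⊔ (S ^ m).ker = ⊤ := by
      rw [Submodule.eq_top_iff']
      intro x
      have hx : (S ^ m) x ∈ rangePow S (m + m) := by
        rw [rangePow_eq_of_hasDescent hq (by omega),
          ← rangePow_eq_of_hasDescent hq (by omega : q ≤ m)]
        exact ⟨x, rfl⟩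
      obtain ⟨y, hy⟩ := hx
      refine Submodule.mem_sup.2 ⟨(S ^ m) y, ⟨y, rfl⟩, x - (S ^ m) y, ?_, by abel⟩
      change (S ^ m) (x - (S ^ m) y) = 0
      rw [map_sub, ← pow_add_apply, sub_eq_zero]
      exact hy.symm
    rw [this]
    exact isClosed_univ

theorem IsDrazinInvertible.isLeftDrazinInvertible {S : X →L[ℂ] X} (h : IsDrazinInvertible S) :
    IsLeftDrazinInvertible S := by
  obtain ⟨p, q, hp, hc⟩ := h.exists_isClosed_rangePow
  exact isLeftDrazinInvertible_of_isClosed (hp.ker_inf_rangePow (Nat.le_add_right p q)) hc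

theorem IsLeftDrazinInvertible.isUpperSemiFredholm {S : X →L[ℂ] X} (h : IsLeftDrazinInvertible S)
    (hf : FiniteDimensional ℂ S.ker) : IsUpperSemiFredholm S := by
  obtain ⟨p, -, hc⟩ := h
  refine ⟨?_, hf⟩
  rw [← coe_rangePow_one]
  induction p with
  | zero => exact hc
  | succ p ih => exact ih (isClosed_rangePow_of_succ_of_finiteDimensional hc)

/-- `0` is not an accumulation point of the eigenvalues of a left Drazin invertible operator. -/
theorem IsLeftDrazinInvertible.exists_pos_forall_eq_zero {S : X →L[ℂ] X}
    (h : IsLeftDrazinInvertible S) :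
    ∃ ε : ℝ, 0 < ε ∧ ∀ z : ℂ, z ≠ 0 → ‖z‖ < ε → ∀ x, S x = z • x → x = 0 := by
  obtain ⟨p, hp, hc⟩ := h
  have hb := hp.ker_inf_rangePow le_rfl
  have hcp := isClosed_rangePow_of_succ hb hc
  have : CompleteSpace (rangePow S p) := hcp.completeSpace_coe
  have hinj : Function.Injective (S.comp (rangePow S p).subtypeL) := by
    rw [injective_iff_map_eq_zero]
    intro x hx
    have : (x : X) ∈ S.ker ⊓ rangePow S p := ⟨hx, x.2⟩
    rw [hb] at this
    exact Subtype.ext this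
  obtain ⟨K, hK⟩ :=
    (S.comp (rangePow S p).subtypeL).antilipschitz_of_injective_of_isClosed_range hinj (by
      have := range_comp_subtypeL_rangePow S p
      rw [← this] at hc
      exact hc)
  -- Eigenvectors for `z ≠ 0` lie in `R(S ^ p)`, where `‖x‖ ≤ K ‖S x‖ = K ‖z‖ ‖x‖`.
  refine ⟨((K : ℝ) + 1)⁻¹, by positivity, fun z hz hlt x hx => ?_⟩
  have h1 : ‖x‖ ≤ K * ‖S x‖ := by
    simpa using hK.le_mul_dist (⟨x, mem_rangePow_of_eq_smul hz hx p⟩ : rangePow S p) 0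
  rw [hx, norm_smul] at h1
  have h2 := mul_lt_mul_of_pos_right hlt (show 0 < (K : ℝ) + 1 by positivity)
  rw [inv_mul_cancel₀ (by positivity)] at h2
  by_contra hne
  have h3 : 0 < ‖x‖ := norm_pos_iff.2 hne
  nlinarith [norm_nonneg z]

end Powers

/-! ### Small shifts of upper semi-B-Fredholm operators -/

section Perturbation

variable {X : Type*} [NormedAddCommGroup X] [NormedSpace ℂ X]

theorem shift_shift (T : X →L[ℂ] X) (a b : ℂ) : shift (shift T a) b = shift T (a + b) := by
  simp only [shift, add_smul]
  abel

theorem mem_approxPointSpectrum_of_eq_smul {T : X →L[ℂ] X} {a z : ℂ} {y : X} (hy : y ≠ 0)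
    (h : shift T a y = z • y) : a + z ∈ approxPointSpectrum T := by
  rintro ⟨c, hc, H⟩
  have h1 := H y
  have h2 : shift T (a + z) y = 0 := by
    rw [← shift_shift]
    exact sub_eq_zero.2 h
  rw [h2, norm_zero] at h1
  have := norm_pos_iff.2 hy
  nlinarith

variable [CompleteSpace X]

theorem IsUpperSemiBFredholm.exists_forall_ker_inf_eq {S : X →L[ℂ] X}
    (h : IsUpperSemiBFredholm S) :
    ∃ n, FiniteDimensional ℂ (S.ker ⊓ rangePow S n : Submodule ℂ X) ∧
      ∀ m, n ≤ m → IsClosed (rangePow S m : Set X) ∧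
        S.ker ⊓ rangePow S m = S.ker ⊓ rangePow S n := by
  obtain ⟨n, hn, hn1, hf⟩ := isUpperSemiBFredholm_iff.1 h
  have hclosed : ∀ m, n ≤ m → IsClosed (rangePow S m : Set X) := by
    intro m hm
    induction m, hm using Nat.le_induction with
    | base => exact hn
    | succ m hm ih =>
      have : CompleteSpace (rangePow S n) := hn.completeSpace_coe
      have := finiteDimensional_ker_comp_subtypeL.2 hf
      have h1 := isClosed_image_of_finiteDimensional_ker (S.comp (rangePow S n).subtypeL)
        (by rw [range_comp_subtypeL_rangePow]; exact hn1)
        ((rangePow S m).comap (rangePow S n).subtype) (ih.preimage continuous_subtype_val)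
      have h2 : (S.comp (rangePow S n).subtypeL) ''
          ((rangePow S m).comap (rangePow S n).subtype : Set (rangePow S n)) =
            rangePow S (m + 1) := by
        rw [← image_rangePow]
        ext z
        constructor
        · rintro ⟨x, hx, rfl⟩
          exact ⟨x, hx, rfl⟩
        · rintro ⟨x, hx, rfl⟩
          exact ⟨⟨x, antitone_rangePow S hm hx⟩, hx, rfl⟩
      rwa [h2] at h1
  have hanti : ∀ a b, a ≤ b → S.ker ⊓ rangePow S b ≤ S.ker ⊓ rangePow S a :=
    fun a b hab => inf_le_inf_left _ (antitone_rangePow S hab)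
  -- A decreasing family of finite-dimensional spaces is constant from an index of minimal dimension
  -- on.
  obtain ⟨m, hm, hmin⟩ := exists_minimalFor_of_wellFoundedLT (fun k => n ≤ k)
    (fun k => Module.finrank ℂ (S.ker ⊓ rangePow S k : Submodule ℂ X)) ⟨n, le_rfl⟩
  have hfm : FiniteDimensional ℂ (S.ker ⊓ rangePow S m : Submodule ℂ X) :=
    Submodule.finiteDimensional_of_le (hanti n m hm)
  refine ⟨m, hfm, fun k hk => ⟨hclosed k (hm.trans hk), ?_⟩⟩
  refine Submodule.eq_of_le_of_finrank_le (hanti m k hk) (hmin (hm.trans hk) ?_)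
  exact Submodule.finrank_mono (hanti m k hk)

/-- An upper semi-B-Fredholm operator is upper semi-Fredholm after small nonzero shifts. -/
theorem IsUpperSemiBFredholm.exists_pos_forall_isUpperSemiFredholm {S : X →L[ℂ] X}
    (h : IsUpperSemiBFredholm S) :
    ∃ ε : ℝ, 0 < ε ∧ ∀ z : ℂ, z ≠ 0 → ‖z‖ < ε → IsUpperSemiFredholm (shift S z) := by
  obtain ⟨n, hn, hn1, hf⟩ := isUpperSemiBFredholm_iff.1 h
  have : CompleteSpace (rangePow S n) := hn.completeSpace_coe
  have := finiteDimensional_ker_comp_subtypeL.2 hf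
  obtain ⟨ε, hε, H⟩ := exists_pos_forall_isClosed_range_sub (S.comp (rangePow S n).subtypeL)
    (rangePow S n).subtypeL (by rw [range_comp_subtypeL_rangePow]; exact hn1)
  refine ⟨ε, hε, fun z hz hlt => ?_⟩
  obtain ⟨hc, hk⟩ := H z hlt
  have heq : S.comp (rangePow S n).subtypeL - z • (rangePow S n).subtypeL =
      (shift S z).comp (rangePow S n).subtypeL := rfl
  rw [heq] at hc hk
  constructor
  · have hcomm : Commute (shift S z) (S ^ n) := by
      refine Commute.pow_right ?_ n
      exact (Commute.refl S).sub_left ((Commute.one_left S).smul_left z)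
    -- As `z ≠ 0`, the polynomials `t - z` and `t ^ n` are coprime: `S - z` divides `S ^ n - z ^ n`,
    -- so membership in `R(S - z)` can be tested after applying `S ^ n`.
    have hr : Set.range (shift S z) =
        (S ^ n : X →L[ℂ] X) ⁻¹' (((shift S z).comp (rangePow S n).subtypeL).range : Set X) := by
      ext x
      constructor
      · rintro ⟨y, rfl⟩
        refine ⟨⟨(S ^ n) y, ⟨y, rfl⟩⟩, ?_⟩
        exact congrArg (fun A : X →L[ℂ] X => A y) hcomm.eq
      · rintro ⟨⟨_, w, rfl⟩, hw⟩
        have hw' : shift S z ((S ^ n) w) = (S ^ n) x := hw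
        have hs : shift S z = S - algebraMap ℂ (X →L[ℂ] X) z := by
          rw [Algebra.algebraMap_eq_smul_one]
          rfl
        obtain ⟨q, hq⟩ : ∃ q : X →L[ℂ] X,
            shift S z * q = S ^ n - algebraMap ℂ (X →L[ℂ] X) (z ^ n) :=
          ⟨_, by rw [hs, map_pow]; exact Commute.mul_geom_sum₂ (Algebra.commutes z S).symm n⟩
        have hqx : shift S z (q x) = (S ^ n) x - z ^ n • x := by
          have := congrArg (fun A : X →L[ℂ] X => A x) hq
          simpa [Algebra.algebraMap_eq_smul_one] using this
        refine ⟨(z ^ n)⁻¹ • ((S ^ n) w - q x), ?_⟩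
        rw [map_smul, map_sub, hw', hqx, sub_sub_cancel, inv_smul_smul₀ (pow_ne_zero n hz)]
    rw [hr]
    exact hc.preimage (S ^ n).continuous
  · rw [finiteDimensional_ker_comp_subtypeL] at hk
    refine Submodule.finiteDimensional_of_le (S₂ := (shift S z).ker ⊓ rangePow S n) fun x hx => ?_
    refine ⟨hx, mem_rangePow_of_eq_smul hz ?_ n⟩
    exact sub_eq_zero.1 hx

/-- An upper semi-B-Fredholm operator is left Drazin invertible unless all small scalars are among
its eigenvalues. -/
theorem IsUpperSemiBFredholm.isLeftDrazinInvertible_or {S : X →L[ℂ] X}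
    (h : IsUpperSemiBFredholm S) :
    IsLeftDrazinInvertible S ∨
      ∃ ε : ℝ, 0 < ε ∧ ∀ z : ℂ, ‖z‖ < ε → ∃ y : X, y ≠ 0 ∧ S y = z • y := by
  obtain ⟨n, hf, H⟩ := h.exists_forall_ker_inf_eq
  by_cases hb : S.ker ⊓ rangePow S n = ⊥
  · exact Or.inl (isLeftDrazinInvertible_of_isClosed hb (H (n + 1) n.le_succ).1)
  right
  let M : Submodule ℂ X := ⨅ k, rangePow S (n + k)
  have hM : IsClosed (M : Set X) := by
    rw [Submodule.coe_iInf]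
    exact isClosed_iInter fun k => (H (n + k) (Nat.le_add_right n k)).1
  have hMmem : ∀ x, x ∈ M ↔ ∀ k, x ∈ rangePow S (n + k) := fun x => Submodule.mem_iInf _
  have hkerM : S.ker ⊓ rangePow S n ≤ M := by
    intro x hx
    rw [hMmem]
    intro k
    rw [← (H (n + k) (Nat.le_add_right n k)).2] at hx
    exact hx.2
  have hmaps : Set.MapsTo S M M := by
    intro x hx
    rw [SetLike.mem_coe, hMmem] at hx ⊢
    exact fun k => mapsTo_rangePow S _ (hx k)
  have : CompleteSpace M := hM.completeSpace_coe
  let f : M →L[ℂ] M := S.restrict hmaps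
  have hsurj : Function.Surjective f := by
    rintro ⟨y, hy⟩
    have hy' := (hMmem y).1 hy
    have hlift : ∀ k, ∃ x ∈ rangePow S (n + k), S x = y := by
      intro k
      have h1 : y ∈ S '' (rangePow S (n + k) : Set X) := by
        rw [image_rangePow]
        exact hy' (k + 1)
      exact h1
    obtain ⟨x, hx, hxy⟩ := hlift 0
    refine ⟨⟨x, (hMmem x).2 fun k => ?_⟩, Subtype.ext hxy⟩
    obtain ⟨w, hw, hwy⟩ := hlift k
    -- Preimages of `y` at different levels differ by an element of `N(S) ∩ R(S ^ n) ⊆ M`, so one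
    -- preimage serves all levels.
    have hd : x - w ∈ S.ker ⊓ rangePow S n := by
      refine ⟨?_, sub_mem hx (antitone_rangePow S (Nat.le_add_right n k) hw)⟩
      change S (x - w) = 0
      rw [map_sub, hxy, hwy, sub_self]
    have := add_mem ((hMmem _).1 (hkerM hd) k) hw
    rwa [sub_add_cancel] at this
  have hfk : FiniteDimensional ℂ f.ker := by
    have he : f.ker = (S.comp M.subtypeL).ker := by
      ext x
      exact Subtype.ext_iff
    rw [he, finiteDimensional_ker_comp_subtypeL]
    exact Submodule.finiteDimensional_of_le (S₂ := S.ker ⊓ rangePow S n)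
      (inf_le_inf_left _ (iInf_le _ 0))
  obtain ⟨x₀, hx₀, hne⟩ := Submodule.exists_mem_ne_zero_of_ne_bot hb
  obtain ⟨ε, hε, hE⟩ := exists_pos_forall_exists_ne_zero f hsurj (x₀ := ⟨x₀, hkerM hx₀⟩)
    (Subtype.ext hx₀.1) (fun h0 => hne (congrArg Subtype.val h0))
  refine ⟨ε, hε, fun z hz => ?_⟩
  obtain ⟨y, hy, hfy⟩ := hE z hz
  exact ⟨y, fun h0 => hy (Subtype.ext h0), congrArg Subtype.val hfy⟩

/-! ### The properties `(bz₁)` and `(gbz₁)` -/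

variable {T : X →L[ℂ] X}

theorem leftPoles_subset (T : X →L[ℂ] X) : leftPoles T ⊆ approxPointSpectrum T \ usbfSpectrum T :=
  fun _ hz => ⟨hz.1, not_not_intro (not_not.1 hz.2).isUpperSemiBFredholm⟩

theorem PropertyGbz1.propertyBz1 (h : PropertyGbz1 T) : PropertyBz1 T := by
  apply Set.Subset.antisymm
  · rintro z ⟨hz, hu⟩
    have hu' : IsUpperSemiFredholm (shift T z) := not_not.1 hu
    refine ⟨?_, hu'.2⟩
    rw [← h]
    exact ⟨hz, not_not_intro hu'.isUpperSemiBFredholm⟩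
  · rintro z ⟨hz, hk⟩
    refine ⟨(h.symm ▸ hz : z ∈ approxPointSpectrum T \ usbfSpectrum T).1, not_not_intro ?_⟩
    have hd : IsDrazinInvertible (shift T z) := not_not.1 hz.2
    exact hd.isLeftDrazinInvertible.isUpperSemiFredholm hk

theorem PropertyGbz1.poles_eq_leftPoles (h : PropertyGbz1 T) : poles T = leftPoles T := by
  apply Set.Subset.antisymm
  · intro z hz
    refine ⟨(h.symm ▸ hz : z ∈ approxPointSpectrum T \ usbfSpectrum T).1, not_not_intro ?_⟩
    have hd : IsDrazinInvertible (shift T z) := not_not.1 hz.2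
    exact hd.isLeftDrazinInvertible
  · rw [← h]
    exact leftPoles_subset T

theorem PropertyBz1.propertyGbz1 (h : PropertyBz1 T) (hp : poles T = leftPoles T) :
    PropertyGbz1 T := by
  apply Set.Subset.antisymm
  · rintro a ⟨ha, hu⟩
    have hu' : IsUpperSemiBFredholm (shift T a) := not_not.1 hu
    rw [hp]
    refine ⟨ha, not_not_intro ?_⟩
    rcases hu'.isLeftDrazinInvertible_or with hl | ⟨ε, hε, hE⟩
    · exact hl
    exfalso
    obtain ⟨δ, hδ, hD⟩ := hu'.exists_pos_forall_isUpperSemiFredholm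
    let r : ℝ := min ε δ / 2
    have hr : 0 < r := half_pos (lt_min hε hδ)
    have hrm : r < min ε δ := half_lt_self (lt_min hε hδ)
    have hnr : ‖(r : ℂ)‖ = r := by rw [Complex.norm_real, Real.norm_of_nonneg hr.le]
    have hfr := hD r (by exact_mod_cast hr.ne') (by rw [hnr]; exact hrm.trans_le (min_le_right _ _))
    obtain ⟨y, hy, hyr⟩ := hE r (by rw [hnr]; exact hrm.trans_le (min_le_left _ _))
    rw [shift_shift] at hfr
    have hmem : a + r ∈ finiteRankPoles T := by
      rw [← h]
      exact ⟨mem_approxPointSpectrum_of_eq_smul hy hyr, not_not_intro hfr⟩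
    have hd : IsDrazinInvertible (shift T (a + r)) := not_not.1 hmem.1.2
    obtain ⟨η, hη, hN⟩ := hd.isLeftDrazinInvertible.exists_pos_forall_eq_zero
    -- Keeps `r + s` within `ε`, so it is an eigenvalue of `T - a`, and `s` within `η`, where `T -
    -- (a + r)` has no nonzero eigenvalue.
    let s : ℝ := min η (ε - r) / 2
    have hεr : 0 < ε - r := sub_pos.2 (hrm.trans_le (min_le_left _ _))
    have hs : 0 < s := half_pos (lt_min hη hεr)
    have hsm : s < min η (ε - r) := half_lt_self (lt_min hη hεr)
    have hns : ‖(s : ℂ)‖ = s := by rw [Complex.norm_real, Real.norm_of_nonneg hs.le]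
    obtain ⟨w, hw, hwr⟩ := hE (r + s) (by
      have h1 := norm_add_le (r : ℂ) s
      have h2 := hsm.trans_le (min_le_right _ _)
      rw [hnr, hns] at h1
      linarith)
    refine hw (hN s (by exact_mod_cast hs.ne')
      (by rw [hns]; exact hsm.trans_le (min_le_left _ _)) w ?_)
    rw [← shift_shift]
    change shift T a w - (r : ℂ) • w = (s : ℂ) • w
    rw [hwr, add_smul, add_sub_cancel_left]
  · rw [hp]
    exact leftPoles_subset T

end Perturbation
end BFredholm

theorem mainTheorem4 {X : Type*} [NormedAddCommGroup X] [NormedSpace ℂ X] [CompleteSpace X]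
    (T : X →L[ℂ] X) :
    (BFredholm.PropertyGbz1 T ↔
        BFredholm.PropertyBz1 T ∧ BFredholm.poles T = BFredholm.leftPoles T) ∧
      (BFredholm.PropertyGbz1 T → BFredholm.PropertyBz1 T) :=
  ⟨⟨fun h => ⟨h.propertyBz1, h.poles_eq_leftPoles⟩, fun h => h.1.propertyGbz1 h.2⟩,
    fun h => h.propertyBz1⟩
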